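/- Dehn monsters exist. Here, for a finite set $X$, the free group $F(X)$ is viewed as the set of freely reduced words in $X\cup X^{-1}$, and a subset of $F(X)$ is called computably enumerable if it is empty or is the range $f(\mathbb{N})$ of a computable function $f:\mathbb{N}\to F(X)$. A group is called recursively presented if it has a presentation $\langle X\mid R\rangle$ with $X$ finite and $R\subseteq F(X)$ computably enumerable. A finitely generated group $G$ is called algorithmically finite if for every finite generating set $X$ of $G$, every infinite computably enumerable subset $W\subseteq F(X)$ contains two distinct words that represent the same element of $G$. A Dehn monster is a group that is infinite, recursively presented and algorithmically finite. The theorem asserts that there exists a Dehn monster. -/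

import Mathlib

/-- A subset `W` of the free group on a finite alphabet is computably enumerable if it is empty or
the range of a function `f : ℕ → F(X)` computed by an algorithm. The algorithm outputs elements of
the free group as freely reduced words in the letters `(i, true)` for `xᵢ` and `(i, false)` for
`xᵢ⁻¹`. -/
def IsComputablyEnumerable {d : ℕ} (W : Set (FreeGroup (Fin d))) : Prop :=
  W = ∅ ∨ ∃ f : ℕ → FreeGroup (Fin d), Computable (fun n => (f n).toWord) ∧ Set.range f = W

/-- A group is recursively presented if it has a presentation with finitely many generators and a
computably enumerable set of relators. -/
def IsRecursivelyPresented (G : Type*) [Group G] : Prop :=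
  ∃ (d : ℕ) (R : Set (FreeGroup (Fin d))),
    IsComputablyEnumerable R ∧ Nonempty (G ≃* PresentedGroup R)

/-- A finitely generated group is algorithmically finite if, for every finite generating tuple `x`,
every infinite computably enumerable set of words in the generators contains two distinct words
that represent the same element of the group. -/
def IsAlgorithmicallyFinite (G : Type*) [Group G] : Prop :=
  Group.FG G ∧
    ∀ (d : ℕ) (x : Fin d → G), Subgroup.closure (Set.range x) = ⊤ →
      ∀ W : Set (FreeGroup (Fin d)), W.Infinite → IsComputablyEnumerable W →
        ∃ u ∈ W, ∃ v ∈ W, u ≠ v ∧ FreeGroup.lift x u = FreeGroup.lift x v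

/-- A Dehn monster is an infinite, recursively presented, algorithmically finite group. -/
def IsDehnMonster (G : Type*) [Group G] : Prop :=
  Infinite G ∧ IsRecursivelyPresented G ∧ IsAlgorithmicallyFinite G

/-! Start from a free group on three generators. For each program `e`, search for distinct outputs
`u`, `v` that agree modulo the `(e + 1)`-st iterated square subgroup, and impose the first `v⁻¹ * u`
found as the relator `r e`. That subgroup has finite index, so by pigeonhole the search succeeds
whenever the program enumerates an infinite set; its members can be enumerated, so the search is
effective (`exists_relators`). Rewriting words handles other generating tuples
(`isAlgorithmicallyFinite_of_surjective`).

The quotient stays infinite by a dual Golod–Shafarevich argument. Squaring an element doubles the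
amount by which its difference operator lowers the degree of functions to `ZMod 2`, so `r e` lowers
it by at least `2 ^ (e + 1) ≥ e + 2`. Let `s n` be the dimension of the functions of degree less
than `n` invariant under inserting relators. The value at `1` and the differences along generators
can be prescribed freely, and invariance costs at most `∑ j < n, s j` dimensions. Hence `1 + 3 * s n
≤ s (n + 1) + ∑ j < n, s j` (`golod_shafarevich`), so `s` is unbounded, while invariant functions
factor through the quotient. -/

/-! ### Functions of bounded degree on a group -/

section Difference

variable {F : Type*} [Group F]

/-- The left difference `w ↦ φ (g * w) - φ w` of a function modulo two. -/
def leftDiff (g : F) : (F → ZMod 2) →ₗ[ZMod 2] (F → ZMod 2) where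
  toFun φ w := φ (g * w) - φ w
  map_add' φ ψ := by ext w; simp only [Pi.add_apply]; ring
  map_smul' c φ := by ext w; simp only [Pi.smul_apply, smul_eq_mul, RingHom.id_apply]; ring

/-- The left translate `w ↦ φ (g * w)` of a function modulo two. -/
def leftShift (g : F) : (F → ZMod 2) →ₗ[ZMod 2] (F → ZMod 2) where
  toFun φ w := φ (g * w)
  map_add' _ _ := rfl
  map_smul' _ _ := rfl

theorem leftDiff_apply (g : F) (φ : F → ZMod 2) (w : F) :
    leftDiff g φ w = φ (g * w) - φ w := rfl

theorem leftShift_apply (g : F) (φ : F → ZMod 2) (w : F) :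
    leftShift g φ w = φ (g * w) := rfl

theorem leftShift_eq (g : F) (φ : F → ZMod 2) : leftShift g φ = φ + leftDiff g φ := by
  ext w; simp [leftDiff_apply, leftShift_apply]

theorem leftDiff_one (φ : F → ZMod 2) : leftDiff 1 φ = 0 := by
  ext w; simp [leftDiff_apply]

theorem leftDiff_mul (g h : F) (φ : F → ZMod 2) :
    leftDiff (g * h) φ = leftShift h (leftDiff g φ) + leftDiff h φ := by
  ext w; simp [leftDiff_apply, leftShift_apply, mul_assoc]

theorem leftDiff_inv (g : F) (φ : F → ZMod 2) :
    leftDiff g⁻¹ φ = -leftShift g⁻¹ (leftDiff g φ) := by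
  ext w; simp [leftDiff_apply, leftShift_apply]

/-- Characteristic two: `g² - 1 = (g - 1)²` in the group algebra. -/
theorem leftDiff_sq (g : F) (φ : F → ZMod 2) :
    leftDiff (g * g) φ = leftDiff g (leftDiff g φ) := by
  have h2 : ∀ x : ZMod 2, x + x = 0 := by decide
  ext w
  simp only [leftDiff_apply, mul_assoc]
  linear_combination h2 (φ (g * w) - φ w)

/-- The elements whose left difference maps `φ` into a translation-invariant submodule. -/
def diffStabilizer (S : Submodule (ZMod 2) (F → ZMod 2)) (hS : ∀ g, ∀ φ ∈ S, leftShift g φ ∈ S)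
    (φ : F → ZMod 2) : Subgroup F where
  carrier := {g | leftDiff g φ ∈ S}
  one_mem' := by simp [leftDiff_one]
  mul_mem' {g h} hg hh := by
    simp only [Set.mem_ofPred_eq, leftDiff_mul] at *
    exact S.add_mem (hS _ _ hg) hh
  inv_mem' {g} hg := by
    simp only [Set.mem_ofPred_eq, leftDiff_inv] at *
    exact S.neg_mem (hS _ _ hg)

end Difference

/-! ### Degree filtration and dimension subgroups modulo two -/

section Degree

variable {α : Type*}

/-- The cocycle identity `leftDiff_mul` makes the admissible `g` a subgroup. -/
theorem leftDiff_mem_of_generators (S : Submodule (ZMod 2) (FreeGroup α → ZMod 2))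
    (hS : ∀ g, ∀ φ ∈ S, leftShift g φ ∈ S) {φ : FreeGroup α → ZMod 2}
    (h : ∀ i, leftDiff (FreeGroup.of i) φ ∈ S) (g : FreeGroup α) : leftDiff g φ ∈ S := by
  have : diffStabilizer S hS φ = ⊤ := by
    rw [eq_top_iff, ← FreeGroup.closure_range_of, Subgroup.closure_le]
    rintro _ ⟨i, rfl⟩
    exact h i
  have hg : g ∈ diffStabilizer S hS φ := this ▸ Subgroup.mem_top g
  exact hg

/-- The functions whose differences along the generators all lie in `S`. -/
def primitives (S : Submodule (ZMod 2) (FreeGroup α → ZMod 2)) :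
    Submodule (ZMod 2) (FreeGroup α → ZMod 2) :=
  ⨅ i, S.comap (leftDiff (FreeGroup.of i))

theorem mem_primitives {S : Submodule (ZMod 2) (FreeGroup α → ZMod 2)}
    {φ : FreeGroup α → ZMod 2} :
    φ ∈ primitives S ↔ ∀ i, leftDiff (FreeGroup.of i) φ ∈ S := by
  simp [primitives]

variable (α) in
/-- The functions on a free group annihilated by all `n`-fold differences. -/
def degreeLT : ℕ → Submodule (ZMod 2) (FreeGroup α → ZMod 2)
  | 0 => ⊥
  | n + 1 => primitives (degreeLT n)

theorem degreeLT_le_succ (n : ℕ) : degreeLT α n ≤ degreeLT α (n + 1) := by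
  induction n with
  | zero => exact bot_le
  | succ n ih =>
    intro φ hφ
    exact mem_primitives.2 fun i => ih (mem_primitives.1 hφ i)

theorem leftShift_mem_degreeLT (n : ℕ) :
    ∀ g, ∀ φ ∈ degreeLT α n, leftShift g φ ∈ degreeLT α n := by
  induction n with
  | zero =>
    intro g φ hφ
    have : φ = 0 := hφ
    subst this
    simp
  | succ n ih =>
    intro g φ hφ
    rw [leftShift_eq]
    exact Submodule.add_mem _ hφ
      (degreeLT_le_succ n (leftDiff_mem_of_generators _ ih (mem_primitives.1 hφ) g))

variable (α) in
/-- The elements of a free group whose difference operator lowers degrees by at least `e`; that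
is, the dimension subgroups modulo two. -/
def dimensionSubgroup (e : ℕ) : Subgroup (FreeGroup α) :=
  ⨅ (n : ℕ) (φ : degreeLT α n), diffStabilizer _ (leftShift_mem_degreeLT (n - e)) φ

/-- Subtraction is truncated: for `n ≤ e` the difference must vanish. -/
theorem mem_dimensionSubgroup {e : ℕ} {g : FreeGroup α} :
    g ∈ dimensionSubgroup α e ↔ ∀ n, ∀ φ ∈ degreeLT α n, leftDiff g φ ∈ degreeLT α (n - e) := by
  simp only [dimensionSubgroup, Subgroup.mem_iInf, Subtype.forall]
  rfl

theorem dimensionSubgroup_one : dimensionSubgroup α 1 = ⊤ := by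
  rw [eq_top_iff]
  intro g _
  rw [mem_dimensionSubgroup]
  rintro (_ | n) φ hφ
  · have : φ = 0 := hφ
    subst this
    simp
  · exact leftDiff_mem_of_generators _ (leftShift_mem_degreeLT n) (mem_primitives.1 hφ) g

theorem dimensionSubgroup_antitone : Antitone (dimensionSubgroup α) := by
  intro a b hab g hg
  rw [mem_dimensionSubgroup] at *
  intro n φ hφ
  exact monotone_nat_of_le_succ degreeLT_le_succ (by omega) (hg n φ hφ)

theorem sq_mem_dimensionSubgroup {e : ℕ} {g : FreeGroup α} (hg : g ∈ dimensionSubgroup α e) :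
    g * g ∈ dimensionSubgroup α (2 * e) := by
  rw [mem_dimensionSubgroup] at *
  intro n φ hφ
  rw [leftDiff_sq]
  have := hg _ _ (hg n φ hφ)
  rwa [Nat.sub_sub, ← two_mul] at this

end Degree

/-! ### The iterated square subgroups -/

section SquareSeries

variable {G : Type*} [Group G]

variable (G) in
/-- The series of subgroups in which each is generated by the squares in the preceding one. -/
def squareSeries : ℕ → Subgroup G
  | 0 => ⊤
  | i + 1 => Subgroup.closure ((fun g => g * g) '' (squareSeries i : Set G))

theorem squareSeries_succ_le (i : ℕ) : squareSeries G (i + 1) ≤ squareSeries G i := by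
  rw [squareSeries, Subgroup.closure_le]
  rintro _ ⟨g, hg, rfl⟩
  exact mul_mem hg hg

theorem squareSeries_antitone : Antitone (squareSeries G) :=
  antitone_nat_of_succ_le squareSeries_succ_le

theorem squareSeries_le_dimensionSubgroup {α : Type*} (i : ℕ) :
    squareSeries (FreeGroup α) i ≤ dimensionSubgroup α (2 ^ i) := by
  induction i with
  | zero => simp [dimensionSubgroup_one]
  | succ i ih =>
    rw [squareSeries, Subgroup.closure_le]
    rintro _ ⟨g, hg, rfl⟩
    rw [pow_succ']
    exact sq_mem_dimensionSubgroup (ih hg)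

/-- The quotient has exponent two, so it is abelian, finitely generated and torsion, hence finite.
-/
theorem finiteIndex_closure_squares [Group.FG G] :
    (Subgroup.closure (Set.range fun g : G => g * g)).FiniteIndex := by
  set N := Subgroup.closure (Set.range fun g : G => g * g) with hN
  have hnormal : N.Normal := by
    refine ⟨fun n hn g => ?_⟩
    induction hn using Subgroup.closure_induction with
    | mem x hx =>
      obtain ⟨y, rfl⟩ := hx
      exact Subgroup.subset_closure ⟨g * y * g⁻¹, by group⟩
    | one => simp
    | mul x y _ _ ihx ihy => simpa [mul_assoc] using mul_mem ihx ihy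
    | inv x _ ih => simpa [mul_assoc] using inv_mem ih
  have hsq : ∀ q : G ⧸ N, q * q = 1 := by
    intro q
    induction q using QuotientGroup.induction_on with
    | H g =>
      rw [← QuotientGroup.mk_mul, QuotientGroup.eq_one_iff]
      exact Subgroup.subset_closure ⟨g, rfl⟩
  let _ : CommGroup (G ⧸ N) :=
    { (inferInstance : Group (G ⧸ N)) with
      mul_comm := fun a b => by
        have hinv : ∀ q : G ⧸ N, q⁻¹ = q := fun q => inv_eq_of_mul_eq_one_left (hsq q)
        rw [← hinv (a * b), mul_inv_rev, hinv, hinv] }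
  have : Finite (G ⧸ N) := by
    refine CommGroup.finite_of_fg_isMulTorsion _ ?_
    intro q
    exact isOfFinOrder_iff_pow_eq_one.2 ⟨2, two_pos, by rw [pow_two, hsq]⟩
  exact Subgroup.finiteIndex_of_finite_quotient

theorem finiteIndex_squareSeries [Group.FG G] (i : ℕ) : (squareSeries G i).FiniteIndex := by
  induction i with
  | zero => rw [squareSeries]; infer_instance
  | succ i ih =>
    -- Schreier: finite index preserves finite generation.
    have : Group.FG (squareSeries G i) := Subgroup.fg_of_index_ne_zero _
    have h := finiteIndex_closure_squares (G := squareSeries G i)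
    have hmap : squareSeries G (i + 1) =
        (Subgroup.closure (Set.range fun g : squareSeries G i => g * g)).map
          (squareSeries G i).subtype := by
      rw [MonoidHom.map_closure, squareSeries]
      congr 1
      ext x
      simp only [Set.mem_image, SetLike.mem_coe, ← Set.range_comp, Set.mem_range,
        Function.comp_apply, Subgroup.coe_subtype, Subgroup.coe_mul, Subtype.exists, exists_prop]
    rw [hmap]
    constructor
    rw [Subgroup.index_map_subtype]
    exact mul_ne_zero h.index_ne_zero ih.index_ne_zero

end SquareSeries

/-! ### The Golod–Shafarevich inequality -/

section GolodShafarevich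

variable {α : Type*}

/-- The functions on a group invariant under insertion of the elements `r e`. -/
def insertionInvariant {F : Type*} [Group F] (r : ℕ → F) : Submodule (ZMod 2) (F → ZMod 2) where
  carrier := {φ | ∀ u e v, φ (u * r e * v) = φ (u * v)}
  add_mem' hφ hψ u e v := by simp only [Pi.add_apply, hφ u e v, hψ u e v]
  zero_mem' _ _ _ := rfl
  smul_mem' c φ hφ u e v := by simp only [Pi.smul_apply, hφ u e v]

/-- The invariant functions of degree less than `n`. -/
def invariantLT (r : ℕ → FreeGroup α) (n : ℕ) : Submodule (ZMod 2) (FreeGroup α → ZMod 2) :=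
  degreeLT α n ⊓ insertionInvariant r

theorem leftShift_mem_insertionInvariant {F : Type*} [Group F] (r : ℕ → F) (g : F)
    (φ : F → ZMod 2) (hφ : φ ∈ insertionInvariant r) : leftShift g φ ∈ insertionInvariant r := by
  intro u e v
  have := hφ (g * u) e v
  simpa only [leftShift_apply, mul_assoc] using this

/-- Every family of functions is the family of differences along the generators of a function. -/
theorem exists_leftDiff_eq (ψ : α → FreeGroup α → ZMod 2) (c : ZMod 2) :
    ∃ φ : FreeGroup α → ZMod 2, φ 1 = c ∧ ∀ i, leftDiff (FreeGroup.of i) φ = ψ i := by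
  -- Skew translations: by freeness they define an action, whose second coordinate integrates `ψ`.
  let p (i : α) : Equiv.Perm (FreeGroup α × ZMod 2) :=
    { toFun := fun x => (FreeGroup.of i * x.1, x.2 + ψ i x.1)
      invFun := fun x => ((FreeGroup.of i)⁻¹ * x.1, x.2 - ψ i ((FreeGroup.of i)⁻¹ * x.1))
      left_inv := fun x => by simp
      right_inv := fun x => by simp }
  let a := FreeGroup.lift p
  have hfst : ∀ g x, (a g x).1 = g * x.1 := by
    intro g
    induction g using FreeGroup.induction_on with
    | C1 => simp
    | of i => intro x; simp [a, p]
    | inv_of i _ => intro x; simp [a, p, Equiv.Perm.inv_def]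
    | mul g h hg hh => intro x; simp [map_mul, hg, hh, mul_assoc]
  refine ⟨fun g => (a g (1, c)).2, by simp, fun i => ?_⟩
  ext w
  have h : a (FreeGroup.of i) = p i := FreeGroup.lift_apply_of
  simp only [leftDiff_apply, map_mul, Equiv.Perm.mul_apply, h]
  simp [p, hfst]

/-- A function is determined by its value at `1` and its differences along the generators. -/
noncomputable def primitivesEquiv (S : Submodule (ZMod 2) (FreeGroup α → ZMod 2)) :
    primitives S ≃ₗ[ZMod 2] ZMod 2 × (α → S) :=
  LinearEquiv.ofBijective
    ((LinearMap.proj 1 ∘ₗ (primitives S).subtype).prod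
      (LinearMap.pi fun i => (leftDiff (FreeGroup.of i)).restrict
        fun _ hφ => mem_primitives.1 hφ i)) <| by
    constructor
    · rw [injective_iff_map_eq_zero]
      rintro ⟨φ, hφ⟩ h
      obtain ⟨h1, h2⟩ := Prod.ext_iff.1 h
      have h3 : ∀ i, leftDiff (FreeGroup.of i) φ ∈
          (⊥ : Submodule (ZMod 2) (FreeGroup α → ZMod 2)) := fun i =>
        congrArg Subtype.val (congrFun h2 i)
      have h4 := leftDiff_mem_of_generators ⊥ (by rintro g _ rfl; simp) h3
      ext w
      have h5 := congrFun ((Submodule.mem_bot _).1 (h4 w)) 1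
      have h6 : φ 1 = 0 := h1
      simpa [leftDiff_apply, h6] using h5
    · rintro ⟨c, ψ⟩
      obtain ⟨φ, h1, h2⟩ := exists_leftDiff_eq (fun i => (ψ i : FreeGroup α → ZMod 2)) c
      refine ⟨⟨φ, mem_primitives.2 fun i => h2 i ▸ (ψ i).2⟩, Prod.ext h1 ?_⟩
      ext i : 2
      exact h2 i

theorem invariantLT_succ_le (r : ℕ → FreeGroup α) (n : ℕ) :
    invariantLT r (n + 1) ≤ primitives (invariantLT r n) := by
  intro φ hφ
  refine mem_primitives.2 fun i => ⟨mem_primitives.1 hφ.1 i, ?_⟩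
  have := Submodule.sub_mem _ (leftShift_mem_insertionInvariant r (FreeGroup.of i) φ hφ.2) hφ.2
  rwa [leftShift_eq, add_sub_cancel_left] at this

instance finite_invariantLT [Finite α] (r : ℕ → FreeGroup α) (n : ℕ) :
    Module.Finite (ZMod 2) (invariantLT r n) := by
  induction n with
  | zero =>
    have : invariantLT r 0 = ⊥ := bot_inf_eq _
    rw [this]
    infer_instance
  | succ n ih =>
    have := Module.Finite.equiv (primitivesEquiv (invariantLT r n)).symm
    exact Submodule.finiteDimensional_of_le (invariantLT_succ_le r n)

variable {r : ℕ → FreeGroup α} (hr : ∀ e, r e ∈ dimensionSubgroup α (e + 2))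

include hr in
theorem leftDiff_relator_mem {n : ℕ} {φ : FreeGroup α → ZMod 2}
    (hφ : φ ∈ primitives (invariantLT r n)) (e : ℕ) :
    leftDiff (r e) φ ∈ invariantLT r (n - 1 - e) := by
  refine ⟨?_, ?_⟩
  · have := mem_dimensionSubgroup.1 (hr e) (n + 1) φ
      (mem_primitives.2 fun i => (mem_primitives.1 hφ i).1)
    rwa [show n + 1 - (e + 2) = n - 1 - e by omega] at this
  · exact leftDiff_mem_of_generators _ (leftShift_mem_insertionInvariant r)
      (fun i => (mem_primitives.1 hφ i).2) _

include hr in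
-- Relators with `e ≥ n` kill `φ` for degree reasons, so only `n` conditions remain.
theorem mem_invariantLT_succ {n : ℕ} {φ : FreeGroup α → ZMod 2}
    (hφ : φ ∈ primitives (invariantLT r n)) (h : ∀ e < n, leftDiff (r e) φ = 0) :
    φ ∈ invariantLT r (n + 1) := by
  refine ⟨mem_primitives.2 fun i => (mem_primitives.1 hφ i).1, fun u e v => ?_⟩
  have h0 : leftDiff (r e) φ = 0 := by
    rcases lt_or_ge e n with he | he
    · exact h e he
    · have := (leftDiff_relator_mem hr hφ e).1
      rw [show n - 1 - e = 0 by omega] at this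
      exact this
  have h1 := congrFun h0 v
  -- Invariance of `leftDiff u φ` carries an insertion after `u` to one at the front.
  have h2 := leftDiff_mem_of_generators _ (leftShift_mem_insertionInvariant r)
      (fun i => (mem_primitives.1 hφ i).2) u 1 e v
  simp only [leftDiff_apply, one_mul, Pi.zero_apply, ← mul_assoc] at h1 h2
  linear_combination h1 + h2

include hr in
-- Rank–nullity for the map `Ψ` collecting the relator differences; its kernel embeds in
-- `invariantLT r (n + 1)`.
theorem golod_shafarevich [Fintype α] (n : ℕ) :
    1 + Fintype.card α * Module.finrank (ZMod 2) (invariantLT r n) ≤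
      Module.finrank (ZMod 2) (invariantLT r (n + 1)) +
        ∑ e ∈ Finset.range n, Module.finrank (ZMod 2) (invariantLT r (n - 1 - e)) := by
  have := Module.Finite.equiv (primitivesEquiv (invariantLT r n)).symm
  let Ψ : primitives (invariantLT r n) →ₗ[ZMod 2] (∀ e : Fin n, invariantLT r (n - 1 - e)) :=
    LinearMap.pi fun e => (leftDiff (r e)).restrict fun _ hφ => leftDiff_relator_mem hr hφ e
  have hker : Module.finrank (ZMod 2) (LinearMap.ker Ψ) ≤
      Module.finrank (ZMod 2) (invariantLT r (n + 1)) := by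
    refine LinearMap.finrank_le_finrank_of_injective
      (f := ((primitives (invariantLT r n)).subtype.restrict
        (p := LinearMap.ker Ψ) (q := invariantLT r (n + 1)) ?_)) ?_
    · intro φ hφ
      refine mem_invariantLT_succ hr φ.2 fun e he => ?_
      exact congrArg Subtype.val (congrFun (LinearMap.mem_ker.1 hφ) ⟨e, he⟩)
    · intro φ ψ h
      have h' := Subtype.ext_iff.1 h
      exact Subtype.ext (Subtype.ext h')
  have hrange : Module.finrank (ZMod 2) (LinearMap.range Ψ) ≤
      ∑ e ∈ Finset.range n, Module.finrank (ZMod 2) (invariantLT r (n - 1 - e)) := by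
    refine (Submodule.finrank_le _).trans ?_
    rw [Module.finrank_pi_fintype, Finset.sum_range]
  have htot := LinearMap.finrank_range_add_finrank_ker Ψ
  rw [(primitivesEquiv (invariantLT r n)).finrank_eq, Module.finrank_prod,
    Module.finrank_pi_fintype] at htot
  simp at htot
  omega

include hr in
theorem le_finrank_invariantLT [Fintype α] (hα : 3 ≤ Fintype.card α) (n : ℕ) :
    n ≤ Module.finrank (ZMod 2) (invariantLT r n) := by
  set s : ℕ → ℕ := fun n => Module.finrank (ZMod 2) (invariantLT r n) with hs
  -- Of three copies of `s n`, one absorbs the sum.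
  have hstep : ∀ n, ∑ j ∈ Finset.range n, s j ≤ s n → 1 + 2 * s n ≤ s (n + 1) := by
    intro n hn
    have h : 1 + Fintype.card α * s n ≤ s (n + 1) + ∑ e ∈ Finset.range n, s (n - 1 - e) :=
      golod_shafarevich hr n
    rw [Finset.sum_range_reflect] at h
    have := Nat.mul_le_mul_right (s n) hα
    omega
  have hsum : ∀ n, ∑ j ∈ Finset.range n, s j ≤ s n := by
    intro n
    induction n with
    | zero => simp
    | succ n ih =>
      have := hstep n ih
      rw [Finset.sum_range_succ]
      omega
  change n ≤ s n
  induction n with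
  | zero => simp
  | succ n ih => have := hstep n (hsum n); omega

/-- Deep relators, one of each depth, define an infinite quotient of a free group on at least three
generators. -/
theorem infinite_presentedGroup [Fintype α] (hα : 3 ≤ Fintype.card α) {r : ℕ → FreeGroup α}
    (hr : ∀ e, r e ∈ dimensionSubgroup α (e + 2)) {R : Set (FreeGroup α)}
    (hR : R ⊆ insert 1 (Set.range r)) : Infinite (PresentedGroup R) := by
  by_contra hfin
  rw [not_infinite_iff_finite] at hfin
  have hinv : ∀ φ ∈ insertionInvariant r, ∀ g ∈ Subgroup.normalClosure R, ∀ u v,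
      φ (u * g * v) = φ (u * v) := by
    intro φ hφ
    let N : Subgroup (FreeGroup α) :=
      { carrier := {g | ∀ u v, φ (u * g * v) = φ (u * v)}
        one_mem' := by simp
        mul_mem' := fun {g h} hg hh u v => by rw [← mul_assoc, hh, hg]
        inv_mem' := fun {g} hg u v => by simpa using (hg (u * g⁻¹) v).symm }
    have hN : N.Normal := ⟨fun g hg x u v => by
      simpa [mul_assoc] using hg (u * x) (x⁻¹ * v)⟩
    refine Subgroup.normalClosure_le_normal (N := N) fun g hg u v => ?_
    rcases hR hg with rfl | ⟨e, rfl⟩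
    · simp
    · exact hφ u e v
  set n := Nat.card (PresentedGroup R) + 1
  have hle := le_finrank_invariantLT hr hα n
  let q : FreeGroup α → PresentedGroup R := PresentedGroup.mk R
  have hq : Function.Surjective q := PresentedGroup.mk_surjective R
  have : Fintype (PresentedGroup R) := Fintype.ofFinite _
  -- An invariant function is determined by its values on coset representatives.
  have hinj : Function.Injective
      (LinearMap.funLeft (ZMod 2) (ZMod 2) (Function.surjInv hq) ∘ₗ
        (invariantLT r n).subtype) := by
    rw [injective_iff_map_eq_zero]
    intro φ hφ
    ext w
    have h1 : (φ : FreeGroup α → ZMod 2) (Function.surjInv hq (q w)) = 0 := congrFun hφ (q w)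
    have h2 : w⁻¹ * Function.surjInv hq (q w) ∈ Subgroup.normalClosure R :=
      QuotientGroup.eq.1 (Function.surjInv_eq hq (q w)).symm
    have h3 := hinv φ φ.2.2 _ h2 w 1
    simp only [mul_inv_cancel_left, mul_one] at h3
    simp [← h3, h1]
  have := LinearMap.finrank_le_finrank_of_injective hinj
  rw [Module.finrank_fintype_fun_eq_card, ← Nat.card_eq_fintype_card] at this
  omega

end GolodShafarevich

/-! ### Enumerating the square series -/

section Enumeration

variable {d : ℕ}

/-- Words representing elements of a free group, not necessarily reduced. -/
abbrev LetterWord (d : ℕ) : Type := List (Fin d × Bool)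

theorem primrec_reduce : Primrec (FreeGroup.reduce : LetterWord d → LetterWord d) := by
  let step (x : Fin d × Bool) (l : LetterWord d) : LetterWord d :=
    l.casesOn [x] fun y t => if x.1 = y.1 ∧ x.2 = !y.2 then t else x :: y :: t
  have hstep : Primrec₂ step := by
    refine Primrec.list_casesOn (f := fun p : (Fin d × Bool) × LetterWord d => p.2)
      (g := fun p => [p.1])
      (h := fun p q => if p.1.1 = q.1.1 ∧ p.1.2 = !q.1.2 then q.2 else p.1 :: q.1 :: q.2)
      Primrec.snd (Primrec.list_cons.comp Primrec.fst (Primrec.const [])) ?_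
    have hx : Primrec fun z : ((Fin d × Bool) × LetterWord d) × ((Fin d × Bool) × LetterWord d) =>
        z.1.1 := Primrec.fst.comp Primrec.fst
    have hy : Primrec fun z : ((Fin d × Bool) × LetterWord d) × ((Fin d × Bool) × LetterWord d) =>
        z.2.1 := Primrec.fst.comp Primrec.snd
    have ht : Primrec fun z : ((Fin d × Bool) × LetterWord d) × ((Fin d × Bool) × LetterWord d) =>
        z.2.2 := Primrec.snd.comp Primrec.snd
    refine Primrec.ite (PrimrecPred.and ?_ ?_) ht
      (Primrec.list_cons.comp hx (Primrec.list_cons.comp hy ht))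
    · exact Primrec.eq.comp (Primrec.fst.comp hx) (Primrec.fst.comp hy)
    · exact Primrec.eq.comp (Primrec.snd.comp hx) (Primrec.not.comp (Primrec.snd.comp hy))
  refine (Primrec.list_foldr Primrec.id (Primrec.const []) (hstep.comp
    (Primrec.fst.comp Primrec.snd) (Primrec.snd.comp Primrec.snd)).to₂).of_eq fun l => ?_
  induction l with
  | nil => rfl
  | cons x l ih =>
    rw [id, List.foldr_cons, FreeGroup.reduce.cons]
    exact congrArg (step x) ih

/-- An instruction `(a, b, w)` extends a list of words, each with a level in the square series, by
the word `w`, the square of entry `a` and the product of entries `a` and `b`. -/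
def deduce (s : List (ℕ × LetterWord d)) (i : ℕ × ℕ × LetterWord d) :
    List (ℕ × LetterWord d) :=
  (0, i.2.2) :: ((s.getD i.1 (0, [])).1 + 1, (s.getD i.1 (0, [])).2 ++ (s.getD i.1 (0, [])).2) ::
    (min (s.getD i.1 (0, [])).1 (s.getD i.2.1 (0, [])).1,
      (s.getD i.1 (0, [])).2 ++ (s.getD i.2.1 (0, [])).2) :: s

theorem primrec_deduce : Primrec₂ (deduce (d := d)) := by
  have ha : Primrec fun z : List (ℕ × LetterWord d) × (ℕ × ℕ × LetterWord d) =>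
      z.1.getD z.2.1 (0, []) :=
    (Primrec.list_getD _).comp Primrec.fst (Primrec.fst.comp Primrec.snd)
  have hb : Primrec fun z : List (ℕ × LetterWord d) × (ℕ × ℕ × LetterWord d) =>
      z.1.getD z.2.2.1 (0, []) :=
    (Primrec.list_getD _).comp Primrec.fst
      (Primrec.fst.comp (Primrec.snd.comp Primrec.snd))
  have hw : Primrec fun z : List (ℕ × LetterWord d) × (ℕ × ℕ × LetterWord d) => z.2.2.2 :=
    Primrec.snd.comp (Primrec.snd.comp Primrec.snd)
  exact Primrec.list_cons.comp ((Primrec.const 0).pair hw)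
    (Primrec.list_cons.comp
      ((Primrec.succ.comp (Primrec.fst.comp ha)).pair
        (Primrec.list_append.comp (Primrec.snd.comp ha) (Primrec.snd.comp ha)))
      (Primrec.list_cons.comp
        ((Primrec.nat_min.comp (Primrec.fst.comp ha) (Primrec.fst.comp hb)).pair
          (Primrec.list_append.comp (Primrec.snd.comp ha) (Primrec.snd.comp hb)))
        Primrec.fst))

/-- Every entry of the list belongs to the term of the square series at its level. -/
def IsSoundList (s : List (ℕ × LetterWord d)) : Prop :=
  ∀ x ∈ s, FreeGroup.mk x.2 ∈ squareSeries (FreeGroup (Fin d)) x.1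

theorem IsSoundList.getD {s : List (ℕ × LetterWord d)} (hs : IsSoundList s) (a : ℕ) :
    FreeGroup.mk (s.getD a (0, [])).2 ∈
      squareSeries (FreeGroup (Fin d)) (s.getD a (0, [])).1 := by
  rcases lt_or_ge a s.length with ha | ha
  · rw [List.getD_eq_getElem _ _ ha]
    exact hs _ (List.getElem_mem ha)
  -- The default `(0, [])` is sound: level `0` is the whole group.
  · rw [List.getD_eq_default _ _ ha]
    exact Subgroup.mem_top _

theorem IsSoundList.deduce {s : List (ℕ × LetterWord d)} (hs : IsSoundList s)
    (i : ℕ × ℕ × LetterWord d) : IsSoundList (deduce s i) := by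
  intro x hx
  simp only [_root_.deduce, List.mem_cons] at hx
  rcases hx with rfl | rfl | rfl | hx
  · exact Subgroup.mem_top _
  · rw [← FreeGroup.mul_mk]
    exact Subgroup.subset_closure ⟨_, hs.getD i.1, rfl⟩
  · rw [← FreeGroup.mul_mk]
    exact mul_mem (squareSeries_antitone (min_le_left _ _) (hs.getD i.1))
      (squareSeries_antitone (min_le_right _ _) (hs.getD i.2.1))
  · exact hs x hx

theorem isSoundList_foldl (p : List (ℕ × ℕ × LetterWord d)) :
    ∀ s : List (ℕ × LetterWord d), IsSoundList s → IsSoundList (p.foldl deduce s) := by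
  induction p with
  | nil => exact fun s hs => hs
  | cons i p ih => exact fun s hs => ih _ (hs.deduce i)

theorem subset_foldl_deduce (p : List (ℕ × ℕ × LetterWord d)) :
    ∀ s : List (ℕ × LetterWord d), s ⊆ p.foldl deduce s := by
  induction p with
  | nil => exact fun s => List.Subset.refl s
  | cons i p ih =>
    intro s
    refine List.Subset.trans ?_ (ih _)
    intro x hx
    simp [deduce, hx]

theorem exists_getD_eq {β : Type*} {s : List β} {x : β} (hx : x ∈ s) (y : β) :
    ∃ a, s.getD a y = x := by
  obtain ⟨a, ha, rfl⟩ := List.getElem_of_mem hx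
  exact ⟨a, List.getD_eq_getElem _ _ ha⟩

/-- Completeness of the instructions. The arbitrary initial list `s` lets programs be concatenated.
-/
theorem exists_foldl_deduce (i : ℕ) : ∀ g ∈ squareSeries (FreeGroup (Fin d)) i,
    ∀ s : List (ℕ × LetterWord d), ∃ (p : List (ℕ × ℕ × LetterWord d)) (w : LetterWord d),
      FreeGroup.mk w = g ∧ (i, w) ∈ p.foldl deduce s := by
  induction i with
  | zero =>
    intro g _ s
    exact ⟨[(0, 0, g.toWord)], g.toWord, FreeGroup.mk_toWord, by simp [deduce]⟩
  | succ i ih =>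
    have hsq : ∀ g ∈ squareSeries (FreeGroup (Fin d)) i, ∀ s : List (ℕ × LetterWord d),
        ∃ (p : List (ℕ × ℕ × LetterWord d)) (w : LetterWord d),
          FreeGroup.mk w = g * g ∧ (i + 1, w) ∈ p.foldl deduce s := by
      intro g hg s
      obtain ⟨p, w, rfl, hw⟩ := ih g hg s
      obtain ⟨a, ha⟩ := exists_getD_eq hw (0, [])
      exact ⟨p ++ [(a, 0, [])], w ++ w, FreeGroup.mul_mk.symm, by
        simp [deduce, ha, -List.getD_eq_getElem?_getD]⟩
    intro g hg
    induction hg using Subgroup.closure_induction'' with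
    | mem x hx =>
      obtain ⟨g, hg, rfl⟩ := hx
      exact hsq g hg
    -- The inverse of a square is a square, so no inversion instruction is needed.
    | inv_mem x hx =>
      obtain ⟨g, hg, rfl⟩ := hx
      simpa using hsq g⁻¹ (inv_mem hg)
    | one => simpa using hsq 1 (one_mem _)
    | mul x y _ _ ihx ihy =>
      intro s
      obtain ⟨p, v, rfl, hv⟩ := ihx s
      obtain ⟨q, w, rfl, hw⟩ := ihy (p.foldl deduce s)
      obtain ⟨a, ha⟩ := exists_getD_eq (subset_foldl_deduce q _ hv) (0, [])
      obtain ⟨b, hb⟩ := exists_getD_eq hw (0, [])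
      refine ⟨p ++ q ++ [(a, b, [])], v ++ w, FreeGroup.mul_mk.symm, ?_⟩
      simp [deduce, ha, hb, -List.getD_eq_getElem?_getD]

end Enumeration

/-! ### Searching for relators -/

section Search

variable {d : ℕ}

/-- The data of a search for a relator: two inputs, a number of steps, two outputs, a program
deriving a member of the square series, and the position of that member. -/
abbrev SearchData (d : ℕ) : Type :=
  (ℕ × ℕ × ℕ) × (LetterWord d × LetterWord d) × (List (ℕ × ℕ × LetterWord d) × ℕ)

/-- The member of the square series derived by the search data, with its level. -/
def derivedEntry (t : SearchData d) : ℕ × LetterWord d :=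
  (t.2.2.1.foldl deduce []).getD t.2.2.2 (0, [])

theorem primrec_derivedEntry : Primrec (derivedEntry (d := d)) :=
  (Primrec.list_getD _).comp
    (Primrec.list_foldl (Primrec.fst.comp (Primrec.snd.comp Primrec.snd)) (Primrec.const [])
      (primrec_deduce.comp (Primrec.fst.comp Primrec.snd) (Primrec.snd.comp Primrec.snd)).to₂)
    (Primrec.snd.comp (Primrec.snd.comp Primrec.snd))

theorem derivedEntry_mem (t : SearchData d) :
    FreeGroup.mk (derivedEntry t).2 ∈ squareSeries (FreeGroup (Fin d)) (derivedEntry t).1 :=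
  IsSoundList.getD (isSoundList_foldl _ [] (by simp [IsSoundList])) _

open Nat.Partrec (Code)

/-- The inputs `a` and `b` make the `e`-th program output the distinct words `u` and `v`, which
differ by the entry `k` of level `e + 1`. -/
def IsCollisionAt (e a b s : ℕ) (u v : LetterWord d) (k : ℕ × LetterWord d) : Prop :=
  (Code.evaln s (Denumerable.ofNat Code e) a = some (Encodable.encode u) ∧
    Code.evaln s (Denumerable.ofNat Code e) b = some (Encodable.encode v)) ∧
  u ≠ v ∧ k.1 = e + 1 ∧ FreeGroup.reduce (v ++ k.2) = FreeGroup.reduce u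

theorem primrecPred_isCollisionAt {β : Type*} [Primcodable β] {e a b s : β → ℕ}
    {u v : β → LetterWord d} {k : β → ℕ × LetterWord d} (he : Primrec e) (ha : Primrec a)
    (hb : Primrec b) (hs : Primrec s) (hu : Primrec u) (hv : Primrec v) (hk : Primrec k) :
    PrimrecPred fun z => IsCollisionAt (e z) (a z) (b z) (s z) (u z) (v z) (k z) := by
  have hc : Primrec fun z => Denumerable.ofNat Code (e z) := (Primrec.ofNat Code).comp he
  have hrun {n : β → ℕ} (hn : Primrec n) : Primrec fun z =>
      Code.evaln (s z) (Denumerable.ofNat Code (e z)) (n z) :=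
    Code.primrec_evaln.comp ((hs.pair hc).pair hn)
  have hout {w : β → LetterWord d} (hw : Primrec w) :
      Primrec fun z => some (Encodable.encode (w z)) :=
    Primrec.option_some.comp (Primrec.encode.comp hw)
  have h₁ := Primrec.eq.comp (hrun ha) (hout hu)
  have h₂ := Primrec.eq.comp (hrun hb) (hout hv)
  have h₃ := (Primrec.eq.comp hu hv).not
  have h₄ := Primrec.eq.comp (Primrec.fst.comp hk) (Primrec.succ.comp he)
  have h₅ := Primrec.eq.comp
    (primrec_reduce.comp (Primrec.list_append.comp hv (Primrec.snd.comp hk)))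
    (primrec_reduce.comp hu)
  exact (h₁.and h₂).and (h₃.and (h₄.and h₅))

/-- The search data exhibit two distinct outputs of the `e`-th program that agree modulo the
`(e + 1)`-st term of the square series. -/
def IsCollision (z : ℕ × SearchData d) : Prop :=
  IsCollisionAt z.1 z.2.1.1 z.2.1.2.1 z.2.1.2.2 z.2.2.1.1 z.2.2.1.2 (derivedEntry z.2)

theorem primrecPred_isCollision : PrimrecPred (IsCollision (d := d)) :=
  primrecPred_isCollisionAt Primrec.fst
    (Primrec.fst.comp (Primrec.fst.comp Primrec.snd))
    (Primrec.fst.comp (Primrec.snd.comp (Primrec.fst.comp Primrec.snd)))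
    (Primrec.snd.comp (Primrec.snd.comp (Primrec.fst.comp Primrec.snd)))
    (Primrec.fst.comp (Primrec.fst.comp (Primrec.snd.comp Primrec.snd)))
    (Primrec.snd.comp (Primrec.fst.comp (Primrec.snd.comp Primrec.snd)))
    (primrec_derivedEntry.comp Primrec.snd)

instance : DecidablePred (IsCollision (d := d)) := fun z => by
  unfold IsCollision IsCollisionAt
  infer_instance

/-- The relator found by the search data with number `m`, if any. -/
def foundRelator (d e m : ℕ) : Option (LetterWord d) :=
  (Encodable.decode (α := SearchData d) m).bind fun t =>
    if IsCollision (e, t) then some (derivedEntry t).2 else none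

theorem primrec_foundRelator : Primrec₂ (foundRelator d) := by
  refine Primrec.option_bind (Primrec.decode.comp Primrec.snd) ?_
  refine Primrec.ite (primrecPred_isCollision.comp
    ((Primrec.fst.comp Primrec.fst).pair Primrec.snd)) ?_ (Primrec.const none)
  exact Primrec.option_some.comp (Primrec.snd.comp (primrec_derivedEntry.comp Primrec.snd))

/-- The first relator found by search data with number less than `m`, if any. -/
def firstRelator (d e : ℕ) : ℕ → Option (LetterWord d)
  | 0 => none
  | m + 1 => (firstRelator d e m).or (foundRelator d e m)

theorem firstRelator_succ (e m : ℕ) :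
    firstRelator d e (m + 1) = (firstRelator d e m).or (foundRelator d e m) := rfl

theorem primrec_firstRelator : Primrec₂ (firstRelator d) := by
  have hor : Primrec₂ (Option.or : Option (LetterWord d) → _ → _) :=
    Primrec.option_orElse.of_eq fun o₁ o₂ => by cases o₁ <;> cases o₂ <;> rfl
  refine (Primrec.nat_rec (f := fun _ : ℕ => (none : Option (LetterWord d)))
    (g := fun e p => p.2.or (foundRelator d e p.1)) (Primrec.const none) ?_).of_eq fun e m => ?_
  · exact hor.comp (Primrec.snd.comp Primrec.snd)
      (primrec_foundRelator.comp Primrec.fst (Primrec.fst.comp Primrec.snd))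
  · induction m with
    | zero => rfl
    | succ m ih => rw [firstRelator_succ, ← ih]

/-- Ensures that each program contributes at most one relator. -/
theorem firstRelator_mono {e m n : ℕ} (hmn : m ≤ n) {w : LetterWord d}
    (h : firstRelator d e m = some w) : firstRelator d e n = some w := by
  induction n, hmn using Nat.le_induction with
  | base => exact h
  | succ n _ ih => rw [firstRelator_succ, ih]; rfl

theorem firstRelator_eq_some {e m : ℕ} {w : LetterWord d} (h : firstRelator d e m = some w) :
    ∃ t : SearchData d, IsCollision (e, t) ∧ (derivedEntry t).2 = w := by
  induction m with
  | zero => cases h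
  | succ m ih =>
    rw [firstRelator_succ] at h
    cases hm : firstRelator d e m with
    | some v =>
      rw [hm] at h
      exact ih (hm.trans h)
    | none =>
      rw [hm] at h
      obtain ⟨t, -, ht⟩ := Option.bind_eq_some_iff.1 (show foundRelator d e m = some w from h)
      by_cases hc : IsCollision (e, t)
      · exact ⟨t, hc, by simpa [hc] using ht⟩
      · simp [hc] at ht

theorem exists_firstRelator {e : ℕ} {t : SearchData d} (ht : IsCollision (e, t)) :
    ∃ m w, firstRelator d e m = some w := by
  refine ⟨Encodable.encode t + 1, ?_⟩
  rw [firstRelator_succ]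
  cases firstRelator d e (Encodable.encode t) with
  | some v => exact ⟨v, rfl⟩
  | none => exact ⟨(derivedEntry t).2, by simp [foundRelator, ht]⟩

/-- There are effectively enumerated relators `r e`, the `e`-th one in the `(e + 1)`-st term of the
square series, that identify two distinct members of every infinite computably enumerable set. -/
theorem exists_relators (d : ℕ) : ∃ (r : ℕ → FreeGroup (Fin d)) (R : Set (FreeGroup (Fin d))),
    (∀ e, r e ∈ squareSeries (FreeGroup (Fin d)) (e + 1)) ∧ R ⊆ insert 1 (Set.range r) ∧
    IsComputablyEnumerable R ∧
    ∀ W : Set (FreeGroup (Fin d)), W.Infinite → IsComputablyEnumerable W →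
      ∃ u ∈ W, ∃ v ∈ W, u ≠ v ∧ v⁻¹ * u ∈ R := by
  classical
  -- Unfinished searches output `1`, so `f` is total and computable; `r` need not be computable.
  let f (n : ℕ) : FreeGroup (Fin d) :=
    FreeGroup.mk ((firstRelator d n.unpair.1 n.unpair.2).getD [])
  let r (e : ℕ) : FreeGroup (Fin d) :=
    if h : ∃ m w, firstRelator d e m = some w then FreeGroup.mk h.choose_spec.choose else 1
  have hr : ∀ {e m w}, firstRelator d e m = some w → r e = FreeGroup.mk w := by
    intro e m w h
    have hex : ∃ m w, firstRelator d e m = some w := ⟨m, w, h⟩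
    have h1 := firstRelator_mono (le_max_left m hex.choose) h
    have h2 := firstRelator_mono (le_max_right m hex.choose) hex.choose_spec.choose_spec
    simp only [r, dif_pos hex]
    rw [Option.some_injective _ (h2.symm.trans h1)]
  refine ⟨r, Set.range f, ?_, ?_, Or.inr ⟨f, ?_, rfl⟩, ?_⟩
  · intro e
    by_cases hex : ∃ m w, firstRelator d e m = some w
    · obtain ⟨m, w, h⟩ := hex
      obtain ⟨t, ht, rfl⟩ := firstRelator_eq_some h
      rw [hr h, ← show (derivedEntry t).1 = e + 1 from ht.2.2.1]
      exact derivedEntry_mem t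
    · simp only [r, dif_neg hex]
      exact one_mem _
  · rintro _ ⟨n, rfl⟩
    cases h : firstRelator d n.unpair.1 n.unpair.2 with
    | none => left; simp only [f, h]; rfl
    | some w => right; exact ⟨n.unpair.1, by simp only [f, h, hr h]; rfl⟩
  · have hf : Primrec fun n => (f n).toWord := by
      simp only [f, FreeGroup.toWord_mk]
      exact primrec_reduce.comp (Primrec.option_getD.comp
        (primrec_firstRelator.comp (Primrec.fst.comp Primrec.unpair)
          (Primrec.snd.comp Primrec.unpair)) (Primrec.const []))
    exact hf.to_comp
  · rintro W hW (rfl | ⟨g, hg, rfl⟩)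
    · exact absurd hW Set.finite_empty.not_infinite
    have hpart : Nat.Partrec fun n => Part.some (Encodable.encode (g n).toWord) :=
      Partrec.nat_iff.1 (Computable.encode.comp hg).partrec
    obtain ⟨c, hc⟩ := Code.exists_code.1 hpart
    have hev : ∀ n, Encodable.encode (g n).toWord ∈ c.eval n := fun n => by
      rw [hc]; exact Part.mem_some _
    set e := Encodable.encode c with he
    have hofNat : Denumerable.ofNat Code e = c := Denumerable.ofNat_encode c
    have hcoll : ∃ t : SearchData d, IsCollision (e, t) := by
      have : (squareSeries (FreeGroup (Fin d)) (e + 1)).FiniteIndex := finiteIndex_squareSeries _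
      have : Finite (FreeGroup (Fin d) ⧸ squareSeries (FreeGroup (Fin d)) (e + 1)) :=
        inferInstance
      obtain ⟨u, hu, v, hv, huv, hq⟩ := hW.exists_ne_map_eq_of_mapsTo
        (f := ((↑) : FreeGroup (Fin d) → FreeGroup (Fin d) ⧸ squareSeries _ (e + 1)))
        (t := Set.univ) (fun _ _ => Set.mem_univ _) Set.finite_univ
      obtain ⟨a, rfl⟩ := hu
      obtain ⟨b, rfl⟩ := hv
      obtain ⟨p, w, hw, hmem⟩ := exists_foldl_deduce (e + 1) _ (QuotientGroup.eq.1 hq.symm) []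
      obtain ⟨j, hj⟩ := exists_getD_eq hmem (0, [])
      obtain ⟨k₁, hk₁⟩ := Code.evaln_complete.1 (hev a)
      obtain ⟨k₂, hk₂⟩ := Code.evaln_complete.1 (hev b)
      refine ⟨((a, b, max k₁ k₂), ((g a).toWord, (g b).toWord), (p, j)), ⟨?_, ?_⟩, ?_, ?_, ?_⟩
      · rw [hofNat]; exact Code.evaln_mono (le_max_left _ _) hk₁
      · rw [hofNat]; exact Code.evaln_mono (le_max_right _ _) hk₂
      · exact fun h => huv (FreeGroup.toWord_injective h)
      · simp only [derivedEntry, hj]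
      · simp only [derivedEntry, hj]
        rw [← FreeGroup.toWord_mk, ← FreeGroup.mul_mk, FreeGroup.mk_toWord, hw,
          mul_inv_cancel_left, FreeGroup.reduce_toWord]
    obtain ⟨t, ht⟩ := hcoll
    obtain ⟨m, w, hmw⟩ := exists_firstRelator ht
    -- The collision found may differ from the pigeonhole one.
    obtain ⟨t, ⟨⟨h1, h2⟩, hne, -, heq⟩, rfl⟩ := firstRelator_eq_some hmw
    have hout : ∀ {k n : ℕ} {l : LetterWord d},
        Code.evaln k (Denumerable.ofNat Code e) n = some (Encodable.encode l) →
          (g n).toWord = l := by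
      intro k n l h
      rw [hofNat] at h
      exact Encodable.encode_injective (Part.mem_unique (hev n) (Code.evaln_sound h))
    have ha := hout h1
    have hb := hout h2
    dsimp only at ha hb hne heq
    refine ⟨g t.1.1, ⟨_, rfl⟩, g t.1.2.1, ⟨_, rfl⟩, ?_, Nat.pair e m, ?_⟩
    · intro h
      rw [← ha, ← hb, h] at hne
      exact hne rfl
    · simp only [f, Nat.unpair_pair, hmw, Option.getD_some]
      rw [eq_inv_mul_iff_mul_eq]
      apply FreeGroup.toWord_injective
      rw [← ha, ← hb, FreeGroup.reduce_toWord] at heq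
      rw [← heq, ← FreeGroup.toWord_mk, ← FreeGroup.mul_mk, FreeGroup.mk_toWord]

end Search

/-! ### Change of generators -/

/-- The image of a computably enumerable set under a homomorphism is computably enumerable. -/
theorem IsComputablyEnumerable.image {d d' : ℕ} {W : Set (FreeGroup (Fin d))}
    (hW : IsComputablyEnumerable W) (φ : FreeGroup (Fin d) →* FreeGroup (Fin d')) :
    IsComputablyEnumerable (φ '' W) := by
  rcases hW with rfl | ⟨f, hf, rfl⟩
  · exact Or.inl (Set.image_empty _)
  refine Or.inr ⟨φ ∘ f, ?_, Set.range_comp _ _⟩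
  let ℓ (x : Fin d × Bool) : LetterWord d' := (φ (FreeGroup.mk [x])).toWord
  have hφ : ∀ w : LetterWord d, φ (FreeGroup.mk w) = FreeGroup.mk (w.flatMap ℓ) := by
    intro w
    induction w with
    | nil => exact map_one φ
    | cons x w ih =>
      rw [List.flatMap_cons, ← FreeGroup.mul_mk, ← ih, FreeGroup.mk_toWord, ← map_mul,
        FreeGroup.mul_mk, List.singleton_append]
  have hprim : Primrec fun w : LetterWord d => FreeGroup.reduce (w.flatMap ℓ) :=
    primrec_reduce.comp
      (Primrec.list_flatMap Primrec.id ((Primrec.dom_finite ℓ).comp Primrec.snd).to₂)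
  refine (hprim.to_comp.comp hf).of_eq fun n => ?_
  rw [Function.comp_apply, ← FreeGroup.toWord_mk, ← hφ, FreeGroup.mk_toWord]

theorem isAlgorithmicallyFinite_of_surjective {G : Type*} [Group G] {d : ℕ}
    (π : FreeGroup (Fin d) →* G) (hπ : Function.Surjective π)
    (h : ∀ W : Set (FreeGroup (Fin d)), W.Infinite → IsComputablyEnumerable W →
      ∃ u ∈ W, ∃ v ∈ W, u ≠ v ∧ π u = π v) : IsAlgorithmicallyFinite G := by
  refine ⟨Group.fg_of_surjective hπ, fun d' x _ W hinf hW => ?_⟩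
  choose y hy using fun i => hπ (x i)
  have hcomp : ∀ w, FreeGroup.lift x w = π (FreeGroup.lift y w) := by
    intro w
    have : FreeGroup.lift x = π.comp (FreeGroup.lift y) := by
      ext i
      simp [hy]
    rw [this, MonoidHom.comp_apply]
  -- If rewriting is injective on `W`, its image is infinite; otherwise it already identifies two
  -- words.
  by_cases hinj : Set.InjOn (FreeGroup.lift y) W
  · obtain ⟨_, ⟨u, hu, rfl⟩, _, ⟨v, hv, rfl⟩, hne, heq⟩ :=
      h _ (hinf.image hinj) (hW.image (FreeGroup.lift y))
    exact ⟨u, hu, v, hv, fun huv => hne (huv ▸ rfl), by rw [hcomp, hcomp, heq]⟩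
  · simp only [Set.InjOn, not_forall] at hinj
    obtain ⟨u, hu, v, hv, heq, hne⟩ := hinj
    exact ⟨u, hu, v, hv, hne, by rw [hcomp, hcomp, heq]⟩

theorem theorem1 : ∃ (G : Type) (_ : Group G), IsDehnMonster G := by
  obtain ⟨r, R, hr, hR, hRce, hW⟩ := exists_relators 3
  refine ⟨PresentedGroup R, inferInstance, ?_, ⟨3, R, hRce, ⟨MulEquiv.refl _⟩⟩, ?_⟩
  · refine infinite_presentedGroup (by simp) (fun e => ?_) hR
    -- Uses `e + 2 ≤ 2 ^ (e + 1)`.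
    exact dimensionSubgroup_antitone (Nat.succ_le_of_lt Nat.lt_two_pow_self)
      (squareSeries_le_dimensionSubgroup _ (hr e))
  · refine isAlgorithmicallyFinite_of_surjective (PresentedGroup.mk R)
      (PresentedGroup.mk_surjective R) fun W hinf hce => ?_
    obtain ⟨u, hu, v, hv, hne, huv⟩ := hW W hinf hce
    refine ⟨u, hu, v, hv, hne, ?_⟩
    exact (QuotientGroup.eq.2 (Subgroup.subset_normalClosure huv)).symm
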